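/- **Theorem (a discrete ODE characterization of total recursive functions).** Consider total functions $f:\mathbb N^p\times\mathbb Z^q\to\mathbb Z$ ($p,q\ge 0$); since $\mathbb N\subseteq\mathbb Z$, an $\mathbb N$-valued function is identified with the $\mathbb Z$-valued function with the same values, and a vector-valued function is said to belong to a class when all its components do. For $f$ on $\mathbb N^{p+1}$ write $\frac{\partial f(x,\mathbf y)}{\partial x}=f(x+1,\mathbf y)-f(x,\mathbf y)$ for $x\in\mathbb N$, $\mathbf y\in\mathbb N^p$. Consider the following three schemata. 1. *Discrete ODE schema*: from $g:\mathbb N^p\to\mathbb N$ and $h:\mathbb Z\times\mathbb N^{p+1}\to\mathbb Z$ obtain the unique $f:\mathbb N^{p+1}\to\mathbb Z$ with $f(0,\mathbf y)=g(\mathbf y)$ and $\frac{\partial f(x,\mathbf y)}{\partial x}=h(f(x,\mathbf y),x,\mathbf y)$. 2. *Linear discrete ODE schema*: for any $k$, from $\mathbf G:\mathbb N^p\to\mathbb N^k$, $\mathbf A:\mathbb N^{p+1}\to\mathbb Z^{k\times k}$ and $\mathbf B:\mathbb N^{p+1}\to\mathbb Z^k$ obtain the unique $\mathbf f:\mathbb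 N^{p+1}\to\mathbb Z^k$ with $\mathbf f(0,\mathbf y)=\mathbf G(\mathbf y)$ and $\frac{\partial \mathbf f(x,\mathbf y)}{\partial x}=\mathbf A(x,\mathbf y)\cdot\mathbf f(x,\mathbf y)+\mathbf B(x,\mathbf y)$. 3. *Scalar linear discrete ODE schema*: the case $k=1$ of schema 2. *Safe minimization*: from $g:\mathbb N^{p+1}\to\mathbb N$ such that for every $\mathbf y$ there is $x$ with $g(x,\mathbf y)=0$, obtain $f:\mathbb N^p\to\mathbb N$, $f(\mathbf y)=\min\{x : g(x,\mathbf y)=0\}$. Let $S$ be any one of the three schemata, and let $\mathcal C_S$ be the smallest class of such functions that contains the zero functions, the projections, the successor $\mathbb N\to\mathbb N$, and the addition and subtraction $\mathbb Z^2\to\mathbb Z$, and that is closed under composition (with $\mathbb N$-valued functions substituted for the arguments in $\mathbb N$, and $\mathbb Z$-valued ones for the arguments in $\mathbb Z$), under $S$, and under safe minimization. Then for every $p$, a function $f:\mathbb N^p\to\mathbb N$ is total recursive (computable) if and only if $f\in\mathcal C_S$. -/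

import Mathlib

namespace DiscreteODE

/-- The functions `ℕ^p × ℤ^q → ℤ`. Since `ℕ ⊆ ℤ`, an `ℕ`-valued function is identified with the
`ℤ`-valued function with the same values. -/
abbrev MixedFun (p q : ℕ) : Type := (Fin p → ℕ) → (Fin q → ℤ) → ℤ

/-- An integer-valued function of natural arguments only, as a function `ℕ^p × ℤ^0 → ℤ`. -/
def ofInt {p : ℕ} (f : (Fin p → ℕ) → ℤ) : MixedFun p 0 := fun n _ => f n

/-- A function `ℕ^p → ℕ`, as a function `ℕ^p × ℤ^0 → ℤ`. -/
def ofNat {p : ℕ} (f : (Fin p → ℕ) → ℕ) : MixedFun p 0 := fun n _ => (f n : ℤ)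

/-- The argument tuple `(x, y)` with `x ∈ ℕ` and `y ∈ ℕ^p`. -/
abbrev args {p : ℕ} (x : ℕ) (y : Fin p → ℕ) : Fin (p + 1) → ℕ := Matrix.vecCons x y

/-- The discrete partial derivative `∂f(x, y)/∂x = f(x + 1, y) - f(x, y)`. -/
def dderiv {p : ℕ} {E : Type} [Sub E] (f : (Fin (p + 1) → ℕ) → E) (x : ℕ) (y : Fin p → ℕ) : E :=
  f (args (x + 1) y) - f (args x y)

/-- `f : ℕ^(p+1) → ℤ` is the solution of the discrete initial value problem
`∂f(x, y)/∂x = h(f(x, y), x, y)`, `f(0, y) = g(y)`, where `g : ℕ^p → ℕ` and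
`h : ℤ × ℕ^(p+1) → ℤ` (the integer argument of `h` is written last). -/
def IsODE {p : ℕ} (g : (Fin p → ℕ) → ℕ) (h : MixedFun (p + 1) 1)
    (f : (Fin (p + 1) → ℕ) → ℤ) : Prop :=
  (∀ y, f (args 0 y) = (g y : ℤ)) ∧
    ∀ x y, dderiv f x y = h (args x y) ![f (args x y)]

/-- `F : ℕ^(p+1) → ℤ^k` is the solution of the linear discrete initial value problem
`∂F(x, y)/∂x = A(x, y) · F(x, y) + B(x, y)`, `F(0, y) = G(y)`, where `G : ℕ^p → ℕ^k`,
`A : ℕ^(p+1) → ℤ^(k×k)` and `B : ℕ^(p+1) → ℤ^k`. -/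
def IsLinearODE {p k : ℕ} (G : (Fin p → ℕ) → Fin k → ℕ)
    (A : (Fin (p + 1) → ℕ) → Matrix (Fin k) (Fin k) ℤ) (B : (Fin (p + 1) → ℕ) → Fin k → ℤ)
    (F : (Fin (p + 1) → ℕ) → Fin k → ℤ) : Prop :=
  (∀ y i, F (args 0 y) i = (G y i : ℤ)) ∧
    ∀ x y, dderiv F x y = (A (args x y)).mulVec (F (args x y)) + B (args x y)

/-- `f : ℕ^(p+1) → ℤ` is the solution of the scalar linear discrete initial value problem
`∂f(x, y)/∂x = a(x, y) · f(x, y) + b(x, y)`, `f(0, y) = g(y)`, where `g : ℕ^p → ℕ` and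
`a, b : ℕ^(p+1) → ℤ`. -/
def IsScalarLinearODE {p : ℕ} (g : (Fin p → ℕ) → ℕ) (a b : (Fin (p + 1) → ℕ) → ℤ)
    (f : (Fin (p + 1) → ℕ) → ℤ) : Prop :=
  (∀ y, f (args 0 y) = (g y : ℤ)) ∧
    ∀ x y, dderiv f x y = a (args x y) * f (args x y) + b (args x y)

/-- `f : ℕ^p → ℕ` is defined from `g : ℕ^(p+1) → ℕ` by safe minimization: for every `y` the set
`{x | g(x, y) = 0}` has a least element (equivalently, is nonempty), and it is `f y`. -/
def IsSafeMin {p : ℕ} (g : (Fin (p + 1) → ℕ) → ℕ) (f : (Fin p → ℕ) → ℕ) : Prop :=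
  ∀ y, IsLeast {x : ℕ | g (args x y) = 0} (f y)

/-- The three discrete ODE schemata. -/
inductive Schema : Type
  /-- discrete ODEs with an arbitrary right-hand side -/
  | general
  /-- linear discrete ODEs in `ℤ^k`, for all `k` -/
  | linear
  /-- linear discrete ODEs in `ℤ` -/
  | scalarLinear

/-- The smallest class of functions `ℕ^p × ℤ^q → ℤ` (all `p`, `q`) that contains the zero
functions, the projections, the successor function, addition and subtraction, and is closed under
composition, the discrete ODE schema `S`, and safe minimization. A vector-valued function belongs
to the class when each of its components does. -/
inductive ODEClass (S : Schema) : {p q : ℕ} → MixedFun p q → Prop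
  | zero {p q : ℕ} : ODEClass S (fun (_ : Fin p → ℕ) (_ : Fin q → ℤ) => 0)
  | projNat {p q : ℕ} (i : Fin p) :
      ODEClass S (fun (n : Fin p → ℕ) (_ : Fin q → ℤ) => (n i : ℤ))
  | projInt {p q : ℕ} (j : Fin q) :
      ODEClass S (fun (_ : Fin p → ℕ) (z : Fin q → ℤ) => z j)
  | succ : ODEClass S (ofNat (fun n : Fin 1 → ℕ => n 0 + 1))
  | add : ODEClass S (fun (_ : Fin 0 → ℕ) (z : Fin 2 → ℤ) => z 0 + z 1)
  | sub : ODEClass S (fun (_ : Fin 0 → ℕ) (z : Fin 2 → ℤ) => z 0 - z 1)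
  /-- Composition: `ℕ`-valued functions are substituted for the natural arguments, `ℤ`-valued
  functions for the integer arguments. -/
  | comp {p q p' q' : ℕ} (f : MixedFun p q)
      (u : Fin p → (Fin p' → ℕ) → (Fin q' → ℤ) → ℕ) (v : Fin q → MixedFun p' q')
      (hf : ODEClass S f) (hu : ∀ i, ODEClass S (fun n z => (u i n z : ℤ)))
      (hv : ∀ j, ODEClass S (v j)) :
      ODEClass S (fun n z => f (fun i => u i n z) (fun j => v j n z))
  | ode (hS : S = Schema.general) {p : ℕ} (g : (Fin p → ℕ) → ℕ) (h : MixedFun (p + 1) 1)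
      (f : (Fin (p + 1) → ℕ) → ℤ) (hg : ODEClass S (ofNat g)) (hh : ODEClass S h)
      (hf : IsODE g h f) : ODEClass S (ofInt f)
  | linear (hS : S = Schema.linear) {p k : ℕ} (G : (Fin p → ℕ) → Fin k → ℕ)
      (A : (Fin (p + 1) → ℕ) → Matrix (Fin k) (Fin k) ℤ) (B : (Fin (p + 1) → ℕ) → Fin k → ℤ)
      (F : (Fin (p + 1) → ℕ) → Fin k → ℤ)
      (hG : ∀ i, ODEClass S (ofNat (fun y => G y i)))
      (hA : ∀ i j, ODEClass S (ofInt (fun n => A n i j)))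
      (hB : ∀ i, ODEClass S (ofInt (fun n => B n i)))
      (hF : IsLinearODE G A B F) (i : Fin k) : ODEClass S (ofInt (fun n => F n i))
  | scalarLinear (hS : S = Schema.scalarLinear) {p : ℕ} (g : (Fin p → ℕ) → ℕ)
      (a b : (Fin (p + 1) → ℕ) → ℤ) (f : (Fin (p + 1) → ℕ) → ℤ)
      (hg : ODEClass S (ofNat g)) (ha : ODEClass S (ofInt a)) (hb : ODEClass S (ofInt b))
      (hf : IsScalarLinearODE g a b f) : ODEClass S (ofInt f)
  | smin {p : ℕ} (g : (Fin (p + 1) → ℕ) → ℕ) (f : (Fin p → ℕ) → ℕ)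
      (hg : ODEClass S (ofNat g)) (hf : IsSafeMin g f) : ODEClass S (ofNat f)

end DiscreteODE

/-!
A recursive function is obtained from the basic functions by bounded sums and safe minimization
alone, and every one of the three schemata provides bounded sums: the equation
`∂f(x, y)/∂x = b(x, y)`, `f(0, y) = 0`, is an instance of each of them
(`IntIn.sum_range_head`). This makes one argument serve all schemata.

From bounded sums come multiplication, hence `(a - b) ^ 2` and the equality relation, hence, with
minimization, negation, order, and the bounded quantifier (`RelIn`). Minimization then gives
truncated subtraction, division and square root, and so Gödel's beta function (`NatIn.beta`). Since
the beta function codes finite sequences, primitive recursion is reduced to the search for a code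
of the sequence of the successive values (`NatIn.prec`). All primitive recursive functions are thus
in the class, and Kleene's normal form theorem reaches all total recursive functions by a single
further minimization, which is safe because the function is total (`NatIn.of_computable`).

Conversely, functions in the class are computable by induction on their construction
(`ODEClass.computable`): the integers being coded by natural numbers, addition and multiplication
of integers are computable, and the solution of a discrete initial value problem is computed by
iterating `f(x + 1, y) = f(x, y) + ∂f(x, y)/∂x`.
-/

namespace DiscreteODE

open Finset

variable {S : Schema} {p : ℕ}

/-! ### Functions of natural arguments in the class -/

/-- The `ℤ`-valued function `f` of natural arguments belongs to the class of the schema `S`. -/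
abbrev IntIn (S : Schema) (f : (Fin p → ℕ) → ℤ) : Prop := ODEClass S (ofInt f)

/-- The `ℕ`-valued function `f` of natural arguments belongs to the class of the schema `S`. -/
abbrev NatIn (S : Schema) (f : (Fin p → ℕ) → ℕ) : Prop := ODEClass S (ofNat f)

lemma IntIn.subst {q : ℕ} {F : (Fin p → ℕ) → ℤ} (hF : IntIn S F)
    {u : Fin p → (Fin q → ℕ) → ℕ} (hu : ∀ i, NatIn S (u i)) :
    IntIn S (fun n => F (fun i => u i n)) :=
  ODEClass.comp (ofInt F) (fun i n _ => u i n) (fun j => j.elim0) hF hu (fun j => j.elim0)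

lemma NatIn.subst {q : ℕ} {f : (Fin p → ℕ) → ℕ} (hf : NatIn S f)
    {u : Fin p → (Fin q → ℕ) → ℕ} (hu : ∀ i, NatIn S (u i)) :
    NatIn S (fun n => f (fun i => u i n)) :=
  IntIn.subst (F := fun n => (f n : ℤ)) hf hu

lemma NatIn.of_intIn {F : (Fin p → ℕ) → ℤ} {f : (Fin p → ℕ) → ℕ} (hF : IntIn S F)
    (h : ∀ n, F n = f n) : NatIn S f := by
  obtain rfl : F = fun n => (f n : ℤ) := funext h
  exact hF

lemma NatIn.of_eq {f g : (Fin p → ℕ) → ℕ} (hf : NatIn S f) (h : ∀ n, f n = g n) : NatIn S g :=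
  (funext h : f = g) ▸ hf

lemma NatIn.proj (i : Fin p) : NatIn S (fun n => n i) := ODEClass.projNat i

lemma NatIn.tail {f : (Fin p → ℕ) → ℕ} (hf : NatIn S f) :
    NatIn S (fun m : Fin (p + 1) → ℕ => f (Fin.tail m)) :=
  hf.subst (u := fun i m => m i.succ) fun i => .proj i.succ

lemma IntIn.add {F G : (Fin p → ℕ) → ℤ} (hF : IntIn S F) (hG : IntIn S G) :
    IntIn S (fun n => F n + G n) :=
  ODEClass.comp _ (fun i => i.elim0) ![ofInt F, ofInt G] .add (fun i => i.elim0)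
    (Fin.forall_fin_two.2 ⟨hF, hG⟩)

lemma IntIn.sub {F G : (Fin p → ℕ) → ℤ} (hF : IntIn S F) (hG : IntIn S G) :
    IntIn S (fun n => F n - G n) :=
  ODEClass.comp _ (fun i => i.elim0) ![ofInt F, ofInt G] .sub (fun i => i.elim0)
    (Fin.forall_fin_two.2 ⟨hF, hG⟩)

lemma NatIn.zero : NatIn S (fun _ : Fin p → ℕ => 0) := ODEClass.zero

lemma NatIn.succ {f : (Fin p → ℕ) → ℕ} (hf : NatIn S f) : NatIn S (fun n => f n + 1) :=
  NatIn.subst (f := fun n : Fin 1 → ℕ => n 0 + 1) (u := fun _ => f) ODEClass.succ fun _ => hf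

lemma NatIn.const (c : ℕ) : NatIn S (fun _ : Fin p → ℕ => c) := by
  induction c with
  | zero => exact .zero
  | succ c ih => exact ih.succ

lemma NatIn.add {f g : (Fin p → ℕ) → ℕ} (hf : NatIn S f) (hg : NatIn S g) :
    NatIn S (fun n => f n + g n) :=
  .of_intIn (IntIn.add hf hg) fun _ => (Nat.cast_add _ _).symm

/-- The only way in which the ODE schema is used: the right-hand side does not depend on the
unknown function, so the solution with initial value `0` is a bounded sum. All three schemata
allow such equations. -/
lemma IntIn.sum_range_head {B : (Fin (p + 1) → ℕ) → ℤ} (hB : IntIn S B) :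
    IntIn S (fun n : Fin (p + 1) → ℕ => ∑ i ∈ range (n 0), B (args i (Fin.tail n))) := by
  have htail (x : ℕ) (y : Fin p → ℕ) : Fin.tail (args x y) = y := rfl
  match S with
  | .general =>
    refine .ode rfl (fun _ => 0) (fun n _ => B n) _ .zero
      (ODEClass.comp (ofInt B) (fun i n _ => n i) (fun j => j.elim0) hB
        (fun i => .projNat i) (fun j => j.elim0)) ⟨fun y => by simp, fun x y => ?_⟩
    simp [dderiv, sum_range_succ, htail]
  | .linear =>
    refine .linear rfl (k := 1) (fun _ _ => 0) (fun _ => 0) (fun n _ => B n)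
      (fun n _ => ∑ i ∈ range (n 0), B (args i (Fin.tail n))) (fun _ => .zero)
      (fun _ _ => .zero) (fun _ => hB) ⟨fun y i => by simp, fun x y => ?_⟩ 0
    ext i
    simp [dderiv, sum_range_succ, htail]
  | .scalarLinear =>
    refine .scalarLinear rfl (fun _ => 0) (fun _ => 0) B _ .zero .zero hB
      ⟨fun y => by simp, fun x y => ?_⟩
    simp [dderiv, sum_range_succ, htail]

lemma NatIn.cons {f : (Fin (p + 1) → ℕ) → ℕ} {b : (Fin p → ℕ) → ℕ} (hf : NatIn S f)
    (hb : NatIn S b) : NatIn S (fun n => f (args (b n) n)) := by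
  have h := hf.subst (u := Matrix.vecCons b fun i n => n i) (Fin.cases hb fun i => .proj i)
  refine h.of_eq fun n => congrArg f (funext fun i => ?_)
  cases i using Fin.cases <;> rfl

lemma NatIn.sum {B : ℕ → (Fin p → ℕ) → ℕ} {b : (Fin p → ℕ) → ℕ}
    (hB : NatIn S (fun m : Fin (p + 1) → ℕ => B (m 0) (Fin.tail m))) (hb : NatIn S b) :
    NatIn S (fun n => ∑ i ∈ range (b n), B i n) := by
  have h := IntIn.sum_range_head (B := fun m => (B (m 0) (Fin.tail m) : ℤ)) hB
  simp only [← Nat.cast_sum] at h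
  exact NatIn.cons (f := fun n => ∑ i ∈ range (n 0), B i (Fin.tail n)) h hb

lemma NatIn.mul {f g : (Fin p → ℕ) → ℕ} (hf : NatIn S f) (hg : NatIn S g) :
    NatIn S (fun n => f n * g n) := by
  have h : NatIn S (fun n => ∑ _i ∈ range (f n), g n) := .sum (B := fun _ => g) hg.tail hf
  simpa using h

/-! ### Relations whose zero-test belongs to the class -/

/-- The relation `P` is the zero set of an `ℕ`-valued function in the class of the schema `S`. -/
def RelIn (S : Schema) (P : (Fin p → ℕ) → Prop) : Prop := ∃ g, NatIn S g ∧ ∀ n, g n = 0 ↔ P n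

lemma RelIn.eq_zero {f : (Fin p → ℕ) → ℕ} (hf : NatIn S f) : RelIn S (fun n => f n = 0) :=
  ⟨f, hf, fun _ => Iff.rfl⟩

/-- Equality is the zero set of `(f - g) ^ 2`, the only `ℕ`-valued distance that is available
before truncated subtraction is. -/
lemma RelIn.eq {f g : (Fin p → ℕ) → ℕ} (hf : NatIn S f) (hg : NatIn S g) :
    RelIn S (fun n => f n = g n) := by
  refine ⟨fun n => ((f n - g n : ℤ) ^ 2).toNat, ?_, fun n => ?_⟩
  · have h : IntIn S (fun n => ((f n * f n : ℕ) + (g n * g n : ℕ) : ℤ)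
        - ((f n * g n : ℕ) + (f n * g n : ℕ) : ℤ)) :=
      .sub (.add (hf.mul hf) (hg.mul hg)) (.add (hf.mul hg) (hf.mul hg))
    refine .of_intIn h fun n => ?_
    rw [Int.toNat_of_nonneg (sq_nonneg _)]
    push_cast
    ring
  · have := sq_nonneg (f n - g n : ℤ)
    rw [Int.toNat_eq_zero, this.ge_iff_eq', sq_eq_zero_iff]
    omega

lemma RelIn.and {P Q : (Fin p → ℕ) → Prop} (hP : RelIn S P) (hQ : RelIn S Q) :
    RelIn S (fun n => P n ∧ Q n) := by
  obtain ⟨f, hf, hfP⟩ := hP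
  obtain ⟨g, hg, hgQ⟩ := hQ
  exact ⟨_, hf.add hg, fun n => by rw [Nat.add_eq_zero_iff, hfP, hgQ]⟩

lemma RelIn.ball {P : ℕ → (Fin p → ℕ) → Prop} {b : (Fin p → ℕ) → ℕ}
    (hP : RelIn S (fun m : Fin (p + 1) → ℕ => P (m 0) (Fin.tail m))) (hb : NatIn S b) :
    RelIn S (fun n => ∀ i < b n, P i n) := by
  obtain ⟨g, hg, hgP⟩ := hP
  refine ⟨_, .sum (B := fun i n => g (args i n)) (b := b) ?_ hb, fun n => ?_⟩
  · convert hg using 4 with m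
    exact Fin.cons_self_tail m
  · simp only [sum_eq_zero_iff, mem_range, hgP]
    rfl

lemma NatIn.of_isLeast {P : ℕ → (Fin p → ℕ) → Prop} {f : (Fin p → ℕ) → ℕ}
    (hP : RelIn S (fun m : Fin (p + 1) → ℕ => P (m 0) (Fin.tail m)))
    (hf : ∀ n, IsLeast {x | P x n} (f n)) : NatIn S f := by
  obtain ⟨g, hg, hgP⟩ := hP
  refine .smin g f hg fun n => ?_
  simpa only [hgP] using! hf n

open Classical in
lemma RelIn.indicator {P : (Fin p → ℕ) → Prop} (hP : RelIn S P) :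
    NatIn S (fun n => if P n then 1 else 0) := by
  obtain ⟨g, hg, hgP⟩ := hP
  -- The sign of `g n` is the least `y` with `g n = 0` or `y = 1`.
  have hsign : NatIn S (fun n => if g n = 0 then 0 else 1) := by
    obtain ⟨d, hd, hdeq⟩ := RelIn.eq (S := S) (.proj (0 : Fin (p + 1))) (.const 1)
    refine .of_isLeast (P := fun y n => g n = 0 ∨ y = 1)
      ⟨_, hg.tail.mul hd, fun m => by rw [mul_eq_zero, hdeq]⟩ fun n => ?_
    split_ifs with h
    · simp [h]
    · simp [h]
  refine .of_intIn (IntIn.sub (NatIn.const 1) hsign) fun n => ?_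
  simp only [← hgP]
  split_ifs <;> simp

lemma RelIn.not {P : (Fin p → ℕ) → Prop} (hP : RelIn S P) : RelIn S (fun n => ¬ P n) := by
  classical
  exact ⟨_, hP.indicator, fun n => by simp⟩

lemma RelIn.lt {f g : (Fin p → ℕ) → ℕ} (hf : NatIn S f) (hg : NatIn S g) :
    RelIn S (fun n => f n < g n) := by
  have h : RelIn S (fun n => ¬ ∀ i < g n, ¬ i = f n) :=
    (RelIn.ball (P := fun i n => ¬ i = f n) (RelIn.eq (.proj 0) hf.tail).not hg).not
  simpa using h

lemma NatIn.ite {P : (Fin p → ℕ) → Prop} [DecidablePred P] {f g : (Fin p → ℕ) → ℕ}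
    (hP : RelIn S P) (hf : NatIn S f) (hg : NatIn S g) :
    NatIn S (fun n => if P n then f n else g n) := by
  refine ((hP.indicator.mul hf).add (hP.not.indicator.mul hg)).of_eq fun n => ?_
  split_ifs <;> simp

/-! ### Gödel's beta function -/

lemma NatIn.sub {f g : (Fin p → ℕ) → ℕ} (hf : NatIn S f) (hg : NatIn S g) :
    NatIn S (fun n => f n - g n) :=
  .of_isLeast (P := fun x n => f n < x + g n + 1)
    (RelIn.lt hf.tail ((NatIn.proj 0).add hg.tail).succ)
    fun n => ⟨by simp only [Set.mem_ofPred_eq]; omega,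
      fun x hx => by simp only [Set.mem_ofPred_eq] at hx; omega⟩

lemma NatIn.div {f g : (Fin p → ℕ) → ℕ} (hf : NatIn S f) (hg : NatIn S g) (hpos : ∀ n, 0 < g n) :
    NatIn S (fun n => f n / g n) :=
  .of_isLeast (P := fun x n => f n < (x + 1) * g n)
    (RelIn.lt hf.tail ((NatIn.proj 0).succ.mul hg.tail))
    fun n => ⟨by
      rw [Set.mem_ofPred_eq, ← Nat.div_lt_iff_lt_mul (hpos n)]
      exact Nat.lt_succ_self _,
      fun x hx => by
        rw [Set.mem_ofPred_eq, ← Nat.div_lt_iff_lt_mul (hpos n)] at hx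
        exact Nat.lt_succ_iff.1 hx⟩

lemma NatIn.mod {f g : (Fin p → ℕ) → ℕ} (hf : NatIn S f) (hg : NatIn S g) (hpos : ∀ n, 0 < g n) :
    NatIn S (fun n => f n % g n) := by
  simpa only [Nat.mod_eq_sub_mul_div] using hf.sub (hg.mul (hf.div hg hpos))

lemma NatIn.sqrt {f : (Fin p → ℕ) → ℕ} (hf : NatIn S f) : NatIn S (fun n => (f n).sqrt) :=
  .of_isLeast (P := fun x n => f n < (x + 1) * (x + 1))
    (RelIn.lt hf.tail ((NatIn.proj 0).succ.mul (NatIn.proj 0).succ))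
    fun _ => ⟨Nat.sqrt_lt.1 (Nat.lt_succ_self _),
      fun _ hx => Nat.lt_succ_iff.1 (Nat.sqrt_lt.2 hx)⟩

lemma NatIn.unpair {f : (Fin p → ℕ) → ℕ} (hf : NatIn S f) :
    NatIn S (fun n => (f n).unpair.1) ∧ NatIn S (fun n => (f n).unpair.2) := by
  have hs := hf.sqrt
  have hr := hf.sub (hs.mul hs)
  have hlt := RelIn.lt hr hs
  constructor
  · simpa only [Nat.unpair, apply_ite Prod.fst] using .ite hlt hr hs
  · simpa only [Nat.unpair, apply_ite Prod.snd] using .ite hlt hs (hr.sub hs)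

lemma NatIn.beta {f g : (Fin p → ℕ) → ℕ} (hf : NatIn S f) (hg : NatIn S g) :
    NatIn S (fun n => Nat.beta (f n) (g n)) :=
  hf.unpair.1.mod (hg.succ.mul hf.unpair.2).succ fun _ => Nat.succ_pos _

/-! ### Recursive functions belong to the class -/

/-- Every finite sequence has a code for `Nat.beta`. -/
lemma exists_beta_eq (a : ℕ → ℕ) (b : ℕ) : ∃ c, ∀ i ≤ b, Nat.beta c i = a i := by
  refine ⟨Nat.unbeta ((List.range (b + 1)).map a), fun i hi => ?_⟩
  simpa using Nat.beta_unbeta_coe ((List.range (b + 1)).map a) ⟨i, by simpa using by omega⟩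

/-- Primitive recursion: the values `F 0, …, F x` of the function to be defined are coded by one
number, and the least correct code is found by safe minimization, since correctness of a code is
expressed by the recursion equations, with a bounded quantifier. -/
lemma NatIn.prec {f : (Fin p → ℕ) → ℕ} {g : (Fin (p + 2) → ℕ) → ℕ} (hf : NatIn S f)
    (hg : NatIn S g) :
    NatIn S (fun n : Fin (p + 1) → ℕ =>
      Nat.rec (motive := fun _ => ℕ) (f (Fin.tail n))
        (fun y IH => g (args y (args IH (Fin.tail n)))) (n 0)) := by
  set F : (Fin (p + 1) → ℕ) → ℕ → ℕ := fun n x =>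
    Nat.rec (motive := fun _ => ℕ) (f (Fin.tail n))
      (fun y IH => g (args y (args IH (Fin.tail n)))) x with hF
  let P : ℕ → (Fin (p + 1) → ℕ) → Prop := fun c n =>
    Nat.beta c 0 = f (Fin.tail n) ∧
      ∀ i < n 0, Nat.beta c (i + 1) = g (args i (args (Nat.beta c i) (Fin.tail n)))
  have hcode (n) : ∃ c, P c n := by
    obtain ⟨c, hc⟩ := exists_beta_eq (F n) (n 0)
    refine ⟨c, hc 0 (Nat.zero_le _), fun i hi => ?_⟩
    rw [hc (i + 1) hi, hc i hi.le]
  have hval {c n} (h : P c n) : ∀ i ≤ n 0, Nat.beta c i = F n i := by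
    intro i hi
    induction i with
    | zero => exact h.1
    | succ i ih => rw [h.2 i hi, ih (Nat.le_of_succ_le hi)]
  have hP : RelIn S (fun m : Fin (p + 1 + 1) → ℕ => P (m 0) (Fin.tail m)) := by
    refine (RelIn.eq (.beta (.proj 0) .zero) hf.tail.tail).and
      (.ball (P := fun i m => Nat.beta (m 0) (i + 1) =
        g (args i (args (Nat.beta (m 0) i) (Fin.tail (Fin.tail m)))))
        (.eq (.beta (.proj 1) (NatIn.proj 0).succ) ?_) (.proj 1))
    have h := hg.subst
      (u := Matrix.vecCons (fun m : Fin (p + 1 + 1 + 1) → ℕ => m 0) (Matrix.vecCons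
        (fun m => Nat.beta (m 1) (m 0)) fun i m => m i.succ.succ.succ))
      (Fin.cases (.proj 0) (Fin.cases (.beta (.proj 1) (.proj 0)) fun i => .proj _))
    refine h.of_eq fun m => congrArg g (funext fun i => ?_)
    exact Fin.cases rfl (Fin.cases rfl fun i => rfl) i
  have hleast : NatIn S (fun n => sInf {c | P c n}) :=
    .of_isLeast hP fun n => ⟨Nat.sInf_mem (hcode n), fun _ => Nat.sInf_le⟩
  exact (hleast.beta (.proj 0)).of_eq fun n => hval (Nat.sInf_mem (hcode n)) _ le_rfl

lemma NatIn.of_primrec' {m : ℕ} {f : List.Vector ℕ m → ℕ} (hf : Nat.Primrec' f) :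
    NatIn S (fun n => f (List.Vector.ofFn n)) := by
  induction hf with
  | zero => exact .zero
  | succ => exact (NatIn.proj 0).succ
  | get i => simpa using NatIn.proj i
  | comp g _ _ hf hg => exact hf.subst hg
  | prec _ _ hf hg =>
    refine (hf.prec hg).of_eq fun n => ?_
    have hhead : (List.Vector.ofFn n).head = n 0 := by rw [← List.Vector.get_zero]; simp
    simp only [hhead, List.Vector.tail_ofFn]
    rfl

lemma NatIn.of_primrec {f : (Fin p → ℕ) → ℕ} (hf : Primrec f) : NatIn S f := by
  have h := NatIn.of_primrec' (S := S)
    (.of_prim (hf.comp (Primrec.vector_get' (α := ℕ) (n := p))))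
  exact h.of_eq fun n => congrArg f (funext (List.Vector.get_ofFn n))

/-- Kleene's normal form: for a computable function `f` there is a primitive recursive `T` such
that `T k a` is `f a + 1` if a program for `f` halts on the input `a` in time `k`, and is `0`
otherwise. -/
lemma exists_primrec_of_computable {α : Type*} [Primcodable α] {f : α → ℕ} (hf : Computable f) :
    ∃ T : ℕ → α → ℕ, Primrec₂ T ∧ (∀ a, ∃ k, ¬ T k a = 0) ∧
      ∀ k a, ¬ T k a = 0 → T k a = f a + 1 := by
  obtain ⟨c, hc⟩ := Nat.Partrec.Code.exists_code.1 hf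
  have heval (a) : f a ∈ c.eval (Encodable.encode a) := by
    rw [hc]
    simp
  refine ⟨fun k a => Encodable.encode (c.evaln k (Encodable.encode a)),
    Primrec.encode.comp (Nat.Partrec.Code.primrec_evaln.comp
      ((Primrec.fst.pair (.const c)).pair (Primrec.encode.comp .snd))), fun a => ?_, ?_⟩
  · obtain ⟨k, hk⟩ := Nat.Partrec.Code.evaln_complete.1 (heval a)
    exact ⟨k, by simp [Option.mem_def.1 hk]⟩
  · intro k a h
    cases hk : c.evaln k (Encodable.encode a) with
    | none => simp [hk] at h
    | some b =>
      have hb : b = f a := Part.mem_unique (Nat.Partrec.Code.evaln_sound hk) (heval a)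
      simp only [hk, hb, Encodable.encode_some, Encodable.encode_nat]

/-- The running time in Kleene's normal form is found by minimization, which is safe because the
program halts on every input. -/
lemma NatIn.of_computable {f : (Fin p → ℕ) → ℕ} (hf : Computable f) : NatIn S f := by
  obtain ⟨T, hTprim, hhalt, hval⟩ := exists_primrec_of_computable hf
  have hT : NatIn S (fun m : Fin (p + 1) → ℕ => T (m 0) (Fin.tail m)) :=
    .of_primrec (hTprim.comp (Primrec.fin_app.comp .id (.const 0))
      (Primrec.fin_curry.2 (Primrec.fin_app.comp .fst (Primrec.fin_succ.comp .snd))))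
  have htime : NatIn S (fun n => sInf {k | ¬ T k n = 0}) :=
    .of_isLeast (P := fun k n => ¬ T k n = 0) (RelIn.eq_zero hT).not
      fun n => ⟨Nat.sInf_mem (hhalt n), fun _ => Nat.sInf_le⟩
  exact ((hT.cons htime).sub (.const 1)).of_eq fun n =>
    Nat.sub_eq_of_eq_add (hval _ n (Nat.sInf_mem (hhalt n)))

/-! ### Computability of integer arithmetic -/

section IntArithmetic

variable {α : Type*} [Primcodable α]

/-- The coding of `ℤ` sends `n` to `2 * n` and `-(n + 1)` to `2 * n + 1`. -/
lemma primrec_int_casesOn {f g : ℕ → ℕ} (hf : Primrec f) (hg : Primrec g) :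
    Primrec fun z : ℤ => Int.casesOn (motive := fun _ => ℕ) z f g := by
  refine (Primrec.ite (Primrec.eq.comp (Primrec.nat_mod.comp Primrec.encode (.const 2)) (.const 0))
    (hf.comp (Primrec.nat_div2.comp Primrec.encode))
    (hg.comp (Primrec.nat_div2.comp Primrec.encode))).of_eq fun z => ?_
  cases z with
  | ofNat n =>
    have h : Encodable.encode (Int.ofNat n) = 2 * n := rfl
    simp only [h, Nat.div2_val]
    simp
  | negSucc n =>
    have h : Encodable.encode (Int.negSucc n) = 2 * n + 1 := rfl
    simp [h, Nat.div2_val, Nat.add_mod]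

lemma primrec_toNat : Primrec Int.toNat :=
  (primrec_int_casesOn .id (.const 0)).of_eq fun z => by cases z <;> rfl

lemma primrec_toNat_neg : Primrec fun z : ℤ => (-z).toNat :=
  (primrec_int_casesOn (.const 0) .succ).of_eq fun z => by
    cases z <;> simp [Int.neg_negSucc]

lemma primrec_intCast : Primrec (fun n : ℕ => (n : ℤ)) :=
  Primrec.encode_iff.1 Primrec.nat_double

lemma primrec_subNatNat : Primrec₂ Int.subNatNat := by
  have hneg : Primrec Int.negSucc := Primrec.encode_iff.1 Primrec.nat_double_succ
  refine (Primrec.nat_casesOn (Primrec.nat_sub.comp .snd .fst)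
    (primrec_intCast.comp (Primrec.nat_sub.comp .fst .snd)) (hneg.comp .snd).to₂).of_eq
    fun ⟨m, n⟩ => ?_
  rw [Int.subNatNat]
  cases n - m <;> rfl

lemma _root_.Computable.int_add {f g : α → ℤ} (hf : Computable f) (hg : Computable g) :
    Computable fun a => f a + g a := by
  have h := primrec_subNatNat.to_comp.comp
    (Primrec.nat_add.to_comp.comp (primrec_toNat.to_comp.comp hf) (primrec_toNat.to_comp.comp hg))
    (Primrec.nat_add.to_comp.comp (primrec_toNat_neg.to_comp.comp hf)
      (primrec_toNat_neg.to_comp.comp hg))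
  refine h.of_eq fun a => ?_
  rw [Int.subNatNat_eq_coe]
  omega

lemma _root_.Computable.int_neg {f : α → ℤ} (hf : Computable f) : Computable fun a => -f a := by
  have h := primrec_subNatNat.to_comp.comp (primrec_toNat_neg.to_comp.comp hf)
    (primrec_toNat.to_comp.comp hf)
  refine h.of_eq fun a => ?_
  rw [Int.subNatNat_eq_coe]
  omega

lemma _root_.Computable.int_sub {f g : α → ℤ} (hf : Computable f) (hg : Computable g) :
    Computable fun a => f a - g a :=
  (hf.int_add hg.int_neg).of_eq fun _ => (sub_eq_add_neg _ _).symm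

lemma _root_.Computable.int_mul {f g : α → ℤ} (hf : Computable f) (hg : Computable g) :
    Computable fun a => f a * g a := by
  have hf₁ := primrec_toNat.to_comp.comp hf
  have hf₂ := primrec_toNat_neg.to_comp.comp hf
  have hg₁ := primrec_toNat.to_comp.comp hg
  have hg₂ := primrec_toNat_neg.to_comp.comp hg
  have h := primrec_subNatNat.to_comp.comp
    (Primrec.nat_add.to_comp.comp (Primrec.nat_mul.to_comp.comp hf₁ hg₁)
      (Primrec.nat_mul.to_comp.comp hf₂ hg₂))
    (Primrec.nat_add.to_comp.comp (Primrec.nat_mul.to_comp.comp hf₁ hg₂)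
      (Primrec.nat_mul.to_comp.comp hf₂ hg₁))
  refine h.of_eq fun a => ?_
  rw [Int.subNatNat_eq_coe]
  nth_rw 5 [← Int.toNat_sub_toNat_neg (f a)]
  nth_rw 5 [← Int.toNat_sub_toNat_neg (g a)]
  push_cast
  ring

lemma _root_.Computable.int_sum {k : ℕ} {f : Fin k → α → ℤ} (hf : ∀ i, Computable (f i)) :
    Computable fun a => ∑ i, f i a := by
  induction k with
  | zero => simpa using Computable.const 0
  | succ k ih =>
    simp only [Fin.sum_univ_succ]
    exact (hf 0).int_add (ih fun i => hf i.succ)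

lemma _root_.Computable.pi_fin {σ : Type*} [Primcodable σ] {k : ℕ} {f : α → Fin k → σ}
    (hf : ∀ i, Computable fun a => f a i) : Computable f :=
  (Primrec.vector_get'.to_comp.comp (Computable.vector_ofFn hf)).of_eq fun a => by
    funext i
    simp

end IntArithmetic

/-! ### Functions in the class are computable -/

lemma computable_apply {σ : Type*} [Primcodable σ] {k : ℕ} (i : Fin k) :
    Computable fun n : Fin k → σ => n i :=
  Computable.fin_app.comp .id (.const i)

lemma computable_tail : Computable fun n : Fin (p + 1) → ℕ => Fin.tail n :=
  .pi_fin fun i => computable_apply i.succ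

lemma computable_args {α : Type*} [Primcodable α] {a : α → ℕ} {b : α → Fin p → ℕ}
    (ha : Computable a) (hb : Computable b) : Computable fun x => args (a x) (b x) :=
  .pi_fin (Fin.cases ha fun i => (computable_apply i).comp hb)

/-- A function whose value at `x + 1` is computed from its value at `x` is computable. This
applies to the solutions of all three kinds of discrete initial value problems. -/
lemma computable_of_step {σ : Type*} [Primcodable σ] {f : (Fin (p + 1) → ℕ) → σ}
    {g : (Fin p → ℕ) → σ} {s : (Fin (p + 1) → ℕ) × σ → σ} (hg : Computable g)
    (hs : Computable s) (h0 : ∀ y, f (args 0 y) = g y)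
    (hstep : ∀ x y, f (args (x + 1) y) = s (args x y, f (args x y))) : Computable f := by
  have h : Computable₂ fun (n : Fin (p + 1) → ℕ) (u : ℕ × σ) => s (args u.1 (Fin.tail n), u.2) :=
    hs.comp ((computable_args (Computable.fst.comp .snd) (computable_tail.comp .fst)).pair
      (Computable.snd.comp .snd))
  refine (Computable.nat_rec (computable_apply 0) (hg.comp computable_tail) h).of_eq fun n => ?_
  have key (x : ℕ) : Nat.rec (motive := fun _ => σ) (g (Fin.tail n))
      (fun y IH => s (args y (Fin.tail n), IH)) x = f (args x (Fin.tail n)) := by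
    induction x with
    | zero => exact (h0 _).symm
    | succ x ih => rw [hstep, ← ih]
  exact (key (n 0)).trans (congrArg f (Fin.cons_self_tail n))

lemma computable_ofInt_iff {f : (Fin p → ℕ) → ℤ} :
    (Computable fun x : (Fin p → ℕ) × (Fin 0 → ℤ) => ofInt f x.1 x.2) ↔ Computable f :=
  ⟨fun h => h.comp (Computable.id.pair (.const ![])), fun h => h.comp .fst⟩

lemma computable_ofNat_iff {f : (Fin p → ℕ) → ℕ} :
    (Computable fun x : (Fin p → ℕ) × (Fin 0 → ℤ) => ofNat f x.1 x.2) ↔ Computable f :=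
  ⟨fun h => (primrec_toNat.to_comp.comp
      (computable_ofInt_iff (f := fun n => (f n : ℤ)).1 h)).of_eq fun n => Int.toNat_natCast (f n),
    fun h => computable_ofInt_iff.2 (primrec_intCast.to_comp.comp h)⟩

lemma computable_of_isSafeMin {g : (Fin (p + 1) → ℕ) → ℕ} {f : (Fin p → ℕ) → ℕ}
    (hg : Computable g) (hf : IsSafeMin g f) : Computable f := by
  have hzero : Computable₂ fun (y : Fin p → ℕ) (x : ℕ) => decide (g (args x y) = 0) :=
    (Primrec.eq (α := ℕ)).decide.to_comp.comp (hg.comp (computable_args .snd .fst)) (.const 0)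
  refine (Partrec.rfind hzero.partrec₂).of_eq fun y => ?_
  refine Part.eq_some_iff.2 (Nat.mem_rfind.2 ⟨?_, fun {m} hm => ?_⟩)
  · simpa using! (hf y).1
  · simpa using! fun h => hm.not_ge ((hf y).2 h)

lemma computable_of_isODE {g : (Fin p → ℕ) → ℕ} {h : MixedFun (p + 1) 1}
    {f : (Fin (p + 1) → ℕ) → ℤ} (hg : Computable g)
    (hh : Computable fun x : (Fin (p + 1) → ℕ) × (Fin 1 → ℤ) => h x.1 x.2) (hf : IsODE g h f) :
    Computable f := by
  have hvec : Computable fun u : (Fin (p + 1) → ℕ) × ℤ => ![u.2] :=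
    .pi_fin fun _ => Computable.snd.of_eq fun _ => (Matrix.cons_val_fin_one _ _ _).symm
  have harg : Computable fun u : (Fin (p + 1) → ℕ) × ℤ => (u.1, ![u.2]) :=
    Computable.fst.pair hvec
  have hrhs := hh.comp harg
  have hs : Computable fun u : (Fin (p + 1) → ℕ) × ℤ => u.2 + h u.1 ![u.2] :=
    Computable.snd.int_add hrhs
  exact computable_of_step (primrec_intCast.to_comp.comp hg) hs hf.1
    fun x y => eq_add_of_sub_eq' (hf.2 x y)

lemma computable_of_isLinearODE {k : ℕ} {G : (Fin p → ℕ) → Fin k → ℕ}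
    {A : (Fin (p + 1) → ℕ) → Matrix (Fin k) (Fin k) ℤ} {B F : (Fin (p + 1) → ℕ) → Fin k → ℤ}
    (hG : ∀ i, Computable fun y => G y i) (hA : ∀ i j, Computable fun n => A n i j)
    (hB : ∀ i, Computable fun n => B n i) (hF : IsLinearODE G A B F) : Computable F := by
  have hs : Computable fun u : (Fin (p + 1) → ℕ) × (Fin k → ℤ) =>
      u.2 + ((A u.1).mulVec u.2 + B u.1) := by
    refine .pi_fin fun i => ?_
    simp only [Pi.add_apply, Matrix.mulVec, dotProduct]
    exact ((computable_apply i).comp .snd).int_add (.int_add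
      (.int_sum fun j => ((hA i j).comp .fst).int_mul ((computable_apply j).comp .snd))
      ((hB i).comp .fst))
  have hG' : Computable fun y i => (G y i : ℤ) :=
    .pi_fin fun i => primrec_intCast.to_comp.comp (hG i)
  exact computable_of_step hG' hs (fun y => funext (hF.1 y))
    fun x y => eq_add_of_sub_eq' (hF.2 x y)

lemma computable_of_isScalarLinearODE {g : (Fin p → ℕ) → ℕ} {a b f : (Fin (p + 1) → ℕ) → ℤ}
    (hg : Computable g) (ha : Computable a) (hb : Computable b)
    (hf : IsScalarLinearODE g a b f) : Computable f := by
  have hs : Computable fun u : (Fin (p + 1) → ℕ) × ℤ => u.2 + (a u.1 * u.2 + b u.1) :=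
    Computable.snd.int_add (((ha.comp .fst).int_mul .snd).int_add (hb.comp .fst))
  exact computable_of_step (primrec_intCast.to_comp.comp hg) hs hf.1
    fun x y => eq_add_of_sub_eq' (hf.2 x y)

lemma computable_comp {q p' q' : ℕ} {f : MixedFun p q}
    {u : Fin p → (Fin p' → ℕ) → (Fin q' → ℤ) → ℕ} {v : Fin q → MixedFun p' q'}
    (hf : Computable fun x : (Fin p → ℕ) × (Fin q → ℤ) => f x.1 x.2)
    (hu : ∀ i, Computable fun x : (Fin p' → ℕ) × (Fin q' → ℤ) => (u i x.1 x.2 : ℤ))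
    (hv : ∀ j, Computable fun x : (Fin p' → ℕ) × (Fin q' → ℤ) => v j x.1 x.2) :
    Computable fun x : (Fin p' → ℕ) × (Fin q' → ℤ) =>
      f (fun i => u i x.1 x.2) (fun j => v j x.1 x.2) := by
  have hu' (i) : Computable fun x : (Fin p' → ℕ) × (Fin q' → ℤ) => u i x.1 x.2 :=
    (primrec_toNat.to_comp.comp (hu i)).of_eq fun x => Int.toNat_natCast (u i x.1 x.2)
  exact hf.comp ((Computable.pi_fin hu').pair (Computable.pi_fin hv))

lemma ODEClass.computable {q : ℕ} {f : MixedFun p q} (hf : ODEClass S f) :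
    Computable fun x : (Fin p → ℕ) × (Fin q → ℤ) => f x.1 x.2 := by
  induction hf with
  | zero => exact .const 0
  | projNat i => exact primrec_intCast.to_comp.comp ((computable_apply i).comp .fst)
  | projInt j => exact (computable_apply j).comp .snd
  | succ => exact computable_ofNat_iff.2 (Computable.succ.comp (computable_apply 0))
  | add => exact ((computable_apply 0).comp .snd).int_add ((computable_apply 1).comp .snd)
  | sub => exact ((computable_apply 0).comp .snd).int_sub ((computable_apply 1).comp .snd)
  | comp _ _ _ _ _ _ hf hu hv => exact computable_comp hf hu hv
  | ode _ _ _ _ _ _ hf hg hh =>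
    exact computable_ofInt_iff.2 (computable_of_isODE (computable_ofNat_iff.1 hg) hh hf)
  | linear _ _ _ _ _ _ _ _ hF i hG hA hB =>
    exact computable_ofInt_iff.2 ((computable_apply i).comp (computable_of_isLinearODE
      (fun i => computable_ofNat_iff.1 (hG i)) (fun i j => computable_ofInt_iff.1 (hA i j))
      (fun i => computable_ofInt_iff.1 (hB i)) hF))
  | scalarLinear _ _ _ _ _ _ _ _ hf hg ha hb =>
    exact computable_ofInt_iff.2 (computable_of_isScalarLinearODE (computable_ofNat_iff.1 hg)
      (computable_ofInt_iff.1 ha) (computable_ofInt_iff.1 hb) hf)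
  | smin _ _ _ hf hg =>
    exact computable_ofNat_iff.2 (computable_of_isSafeMin (computable_ofNat_iff.1 hg) hf)

end DiscreteODE

theorem mainTheorem6 (S : DiscreteODE.Schema) (p : ℕ) (f : (Fin p → ℕ) → ℕ) :
    Computable f ↔ DiscreteODE.ODEClass S (DiscreteODE.ofNat f) :=
  ⟨DiscreteODE.NatIn.of_computable, fun h => DiscreteODE.computable_ofNat_iff.1 h.computable⟩
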